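/- **Conventions.** Let $T$ be a complete first-order theory in a language $L$, let $\mathfrak M$ be a monster model of $T$, i.e. a saturated model with $|\mathfrak M|>\max(|L|,\aleph_0)$, and let $A\subseteq \mathfrak M$ with $|A|<|\mathfrak M|$. (A many-sorted theory is read as a one-sorted one with unary predicates for the sorts.) Types are complete types in finitely many variables, tuples are finite, $p(\mathfrak M)$ is the set of realizations of $p$ in $\mathfrak M$. A subset of $p(\mathfrak M)$, or a relation on it, is *relatively ($A$-)definable* if it is the trace on $p(\mathfrak M)$ of a set definable in $\mathfrak M$ (with parameters from $A$). A subset of a linear order is *left-eventual* (*right-eventual*) if it contains a non-empty initial (final) part. An *so-pair over $A$* is a pair $\mathbf p=(p,<)$, where $p\in S(A)$ and $<$ is a relatively $A$-definable linear order on $p(\mathfrak M)$ such that for every relatively definable $D\subseteq p(\mathfrak M)$ exactly one of $D$ and $p(\mathfrak M)\smallsetminus D$ is left-eventual and exactly one of them is right-eventual in $(p(\mathfrak M),<)$. Then $p$ is an *so-type over $A$*, and $\mathbf p^*=(p,>)$ is the *reverse* of $\mathbf p$. The pair $\mathbf p$ and the type $p$ are *non-algebraic* if $p(\mathfrak M)$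 is infinite. For a set $B$ with $|B|<|\mathfrak M|$, a tuple $a\models p$ is *left (right) $\mathbf p$-generic over $B$* if it satisfies every formula $\phi(x)$ over $A\cup B$ for which $\phi(\mathfrak M)\cap p(\mathfrak M)$ is left-eventual (right-eventual) in $(p(\mathfrak M),<)$. Write $a\perp\!\!\!\perp_A b$ (independence) if $\mathrm{tp}(a/Ab)$ does not fork over $A$. For $p,q\in S(A)$: * $p\perp^w q$ if $p(x)\cup q(y)$ determines a complete type over $A$, and $p\not\perp^w q$ otherwise; so-pairs $(p,<_p)$ and $(q,<_q)$ are weakly nonorthogonal if $p\not\perp^w q$; * $p\perp^f q$ if $a\perp\!\!\!\perp_A b$ for all $a\models p$, $b\models q$, and $p\not\perp^f q$ otherwise. So-pairs $\mathbf p=(p,<_p)$ and $\mathbf q=(q,<_q)$ over $A$ are *directly nonorthogonal*, $\delta_A(\mathbf p,\mathbf q)$, if $p\not\perp^w q$ and for all $a\models p$, $b\models q$: $a$ is left $\mathbf p$-generic over $b$ if and only if $b$ is right $\mathbf q$-generic over $a$, and $a$ is right $\mathbf p$-generic over $b$ if and only if $b$ is left $\mathbf q$-generic over $a$. **Theorem.**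 Let $\mathcal S_A$ be the set of all non-algebraic so-types over $A$, $\mathcal P_A$ the set of all non-algebraic so-pairs over $A$, and $\mathcal S_A(\mathfrak M)$ the set of all realizations in $\mathfrak M$ of types from $\mathcal S_A$. 1. $\not\perp^w$ is an equivalence relation on $\mathcal S_A$ and on $\mathcal P_A$. 2. $\delta_A$ is an equivalence relation on $\mathcal P_A$ that refines $\not\perp^w$; each $\not\perp^w$-class in $\mathcal P_A$ is the union of exactly two (disjoint) $\delta_A$-classes, each of them consisting of the reverses of the pairs from the other. 3. Forking dependence, i.e. the negation of $x\perp\!\!\!\perp_A y$, is an equivalence relation on $\mathcal S_A(\mathfrak M)$. 4. $\not\perp^f$ is an equivalence relation on $\mathcal S_A$. -/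

import Mathlib

open FirstOrder Cardinal
open scoped FirstOrder

universe u v w

namespace SOTypes

/-! ### Saturated models, types, definability -/

section Basic

variable (L : FirstOrder.Language.{u, v})

/-- `M` is saturated: for every parameter set `A` with `|A| < |M|` and every `n`, each set of
`L_A`-formulas in `n` variables that is finitely satisfiable in `M` is realized in `M`. -/
def IsSaturated (M : Type w) [L.Structure M] : Prop :=
  ∀ A : Set M, #A < #M → ∀ (n : ℕ) (S : Set (L[[A]].Formula (Fin n))),
    (∀ S₀ : Finset (L[[A]].Formula (Fin n)), (S₀ : Set (L[[A]].Formula (Fin n))) ⊆ S →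
      ∃ a : Fin n → M, ∀ φ ∈ S₀, φ.Realize a) →
    ∃ a : Fin n → M, ∀ φ ∈ S, φ.Realize a

/-- `M` is a monster model (of its complete theory): a saturated structure that is uncountable and
larger than its language. -/
structure IsMonster (M : Type w) [L.Structure M] : Prop where
  saturated : IsSaturated L M
  large : Cardinal.lift.{w} (max ℵ₀ L.card) < Cardinal.lift.{max u v} #M

variable {M : Type w} [L.Structure M]

/-- The space of complete types over `A` in the variables `α`. -/
abbrev TypeOver (A : Set M) (α : Type) :=
  (L[[A]].completeTheory M).CompleteType α

variable [Nonempty M]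

/-- `tp(a / A)`. -/
def tp (A : Set M) {α : Type} (a : α → M) : TypeOver L A α :=
  (L[[A]].completeTheory M).typeOf a

end Basic

variable {L : FirstOrder.Language.{u, v}} {M : Type w} [L.Structure M] [Nonempty M]

/-- The set `p(M)` of realizations of `p`. -/
def locus {A : Set M} {α : Type} (p : TypeOver L A α) : Set (α → M) :=
  {a | tp L A a = p}

/-- `X ⊆ p(M)` is relatively definable (with arbitrary parameters from `M`) within `p(M)`. -/
def RelDefinable {A : Set M} {α : Type} (p : TypeOver L A α) (X : Set (locus p)) : Prop :=
  ∃ D : Set (α → M), (Set.univ : Set M).Definable L D ∧ ∀ a : locus p, a ∈ X ↔ (a : α → M) ∈ D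

/-- The binary relation `R` on `p(M)`, where `p` is over `A`, is relatively `A`-definable. -/
def RelDefinableRel {A : Set M} {α : Type} (p : TypeOver L A α)
    (R : locus p → locus p → Prop) : Prop :=
  ∃ D : Set (α ⊕ α → M), A.Definable L D ∧
    ∀ a b : locus p, R a b ↔ Sum.elim (a : α → M) (b : α → M) ∈ D

/-! ### Linear orders -/

/-- `D` contains a non-empty initial part of the strict order `lt`. -/
def LeftEventual {X : Type*} (lt : X → X → Prop) (D : Set X) : Prop :=
  ∃ I ⊆ D, I.Nonempty ∧ ∀ a ∈ I, ∀ b, lt b a → b ∈ I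

/-- `D` contains a non-empty final part of the strict order `lt`. -/
def RightEventual {X : Type*} (lt : X → X → Prop) (D : Set X) : Prop :=
  ∃ F ⊆ D, F.Nonempty ∧ ∀ a ∈ F, ∀ b, lt a b → b ∈ F

/-! ### Stationarily ordered types and pairs -/

/-- `(p, lt)` is an so-pair over `A`. -/
structure IsSOPair {A : Set M} {α : Type} (p : TypeOver L A α)
    (lt : locus p → locus p → Prop) : Prop where
  linear : IsStrictTotalOrder (locus p) lt
  definable : RelDefinableRel p lt
  left : ∀ D : Set (locus p), RelDefinable p D → Xor (LeftEventual lt D) (LeftEventual lt Dᶜ)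
  right : ∀ D : Set (locus p), RelDefinable p D → Xor (RightEventual lt D) (RightEventual lt Dᶜ)

/-- `p` is stationarily ordered. -/
def IsSOType {A : Set M} {α : Type} (p : TypeOver L A α) : Prop :=
  ∃ lt : locus p → locus p → Prop, IsSOPair p lt

theorem IsSOPair.swap {A : Set M} {α : Type} {p : TypeOver L A α}
    {lt : locus p → locus p → Prop} (h : IsSOPair p lt) : IsSOPair p (fun a b => lt b a) where
  linear := haveI := h.linear; (inferInstance : IsStrictTotalOrder _ (Function.swap lt))
  definable := by
    obtain ⟨D, hD, h'⟩ := h.definable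
    refine ⟨_, hD.preimage_comp (f := Sum.swap), fun a b => ?_⟩
    refine (h' b a).trans ?_
    rw [Set.mem_preimage]
    have : (Sum.elim (a : α → M) (b : α → M)) ∘ Sum.swap = Sum.elim (b : α → M) (a : α → M) := by
      funext x; cases x <;> rfl
    rw [this]
  left := h.right
  right := h.left

variable (L) in
/-- A non-algebraic so-type over `A`, in finitely many variables. -/
structure NonalgSOType (A : Set M) where
  n : ℕ
  type : TypeOver L A (Fin n)
  isSO : IsSOType type
  nonalgebraic : (locus type).Infinite

variable (L) in
/-- A non-algebraic so-pair over `A`: an so-pair `(p, lt)` with `p(M)` infinite. -/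
structure NonalgSOPair (A : Set M) where
  n : ℕ
  type : TypeOver L A (Fin n)
  lt : locus type → locus type → Prop
  isSO : IsSOPair type lt
  nonalgebraic : (locus type).Infinite

variable (L) in
/-- A realization of a non-algebraic so-type over `A`. -/
structure NonalgSORealization (A : Set M) where
  n : ℕ
  tuple : Fin n → M
  isSO : IsSOType (tp L A tuple)
  nonalgebraic : (locus (tp L A tuple)).Infinite

/-- The reverse `(p, >)` of `(p, <)`. -/
def NonalgSOPair.reverse {A : Set M} (P : NonalgSOPair L A) : NonalgSOPair L A where
  n := P.n
  type := P.type
  lt := fun a b => P.lt b a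
  isSO := P.isSO.swap
  nonalgebraic := P.nonalgebraic

/-- The restriction to `C` of the left globalization of `(p, lt)`: all `L_C`-formulas that
relatively define a left-eventual subset of `p(M)`. For `C = M` this is the left globalization. -/
def NonalgSOPair.leftGlobalization {A : Set M} (P : NonalgSOPair L A) (C : Set M) :
    Set (L[[C]].Formula (Fin P.n)) :=
  {φ | LeftEventual P.lt {a : locus P.type | φ.Realize (a : Fin P.n → M)}}

/-- The restriction to `C` of the right globalization of `(p, lt)`. -/
def NonalgSOPair.rightGlobalization {A : Set M} (P : NonalgSOPair L A) (C : Set M) :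
    Set (L[[C]].Formula (Fin P.n)) :=
  {φ | RightEventual P.lt {a : locus P.type | φ.Realize (a : Fin P.n → M)}}

/-- `a` is left generic over `B` with respect to the so-pair `P` over `A`: it realizes the
restriction to `A ∪ B` of the left globalization. -/
def NonalgSOPair.LeftGeneric {A : Set M} (P : NonalgSOPair L A) (B : Set M) (a : Fin P.n → M) : Prop :=
  ∀ φ ∈ P.leftGlobalization (A ∪ B), φ.Realize a

/-- `a` is right generic over `B` with respect to the so-pair `P` over `A`. -/
def NonalgSOPair.RightGeneric {A : Set M} (P : NonalgSOPair L A) (B : Set M) (a : Fin P.n → M) : Prop :=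
  ∀ φ ∈ P.rightGlobalization (A ∪ B), φ.Realize a

/-! ### Dividing and forking -/

/-- The formula `φ(x, b)` divides over `A`: for some `k` and some sequence `(b_i)` of realizations
of `tp(b / A)`, the family `φ(x, b_i)` is `k`-inconsistent. Parameters from `A` may be among the
entries of `b`. -/
def Divides (A : Set M) {α : Type} {m : ℕ} (φ : L.Formula (α ⊕ Fin m)) (b : Fin m → M) : Prop :=
  ∃ (k : ℕ) (c : ℕ → Fin m → M), (∀ i, tp L A (c i) = tp L A b) ∧
    ∀ s : Finset ℕ, s.card = k → ¬ ∃ x : α → M, ∀ i ∈ s, φ.Realize (Sum.elim x (c i))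

/-- The complete type `q` over the small set `C` forks over `A`: it implies a finite disjunction
of formulas that divide over `A`. -/
def Forks (A : Set M) {C : Set M} {α : Type} (q : TypeOver L C α) : Prop :=
  ∃ (k : ℕ) (m : Fin k → ℕ) (φ : ∀ j, L.Formula (α ⊕ Fin (m j))) (b : ∀ j, Fin (m j) → M),
    (∀ j, Divides A (φ j) (b j)) ∧ ∀ x ∈ locus q, ∃ j, (φ j).Realize (Sum.elim x (b j))

variable (L) in
/-- `tp(a / A ∪ b)` does not fork over `A`. -/
def Indep (A : Set M) {α β : Type} (a : α → M) (b : β → M) : Prop :=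
  ¬ Forks A (tp L (A ∪ Set.range b) a)

/-! ### Orthogonality relations -/

/-- Weak orthogonality: `p(x) ∪ q(y)` determines a complete type over `A`. -/
def WeaklyOrthogonal {A : Set M} {α β : Type} (p : TypeOver L A α) (q : TypeOver L A β) : Prop :=
  ∀ a ∈ locus p, ∀ b ∈ locus q, ∀ a' ∈ locus p, ∀ b' ∈ locus q,
    tp L A (Sum.elim a b) = tp L A (Sum.elim a' b')

/-- Forking orthogonality. -/
def ForkingOrthogonal {A : Set M} {α β : Type} (p : TypeOver L A α) (q : TypeOver L A β) : Prop :=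
  ∀ a ∈ locus p, ∀ b ∈ locus q, Indep L A a b

/-- Direct nonorthogonality of so-pairs over `A`. -/
def DirectlyNonorthogonal {A : Set M} (P Q : NonalgSOPair L A) : Prop :=
  ¬ WeaklyOrthogonal P.type Q.type ∧
    ∀ a ∈ locus P.type, ∀ b ∈ locus Q.type,
      (P.LeftGeneric (Set.range b) a ↔ Q.RightGeneric (Set.range a) b) ∧
      (P.RightGeneric (Set.range b) a ↔ Q.LeftGeneric (Set.range a) b)

end SOTypes

namespace SOTypes

variable {L : FirstOrder.Language.{u, v}} {M : Type w} [L.Structure M]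

/-! ### Types and definable sets -/

/-- Fibers of definable sets are definable over the additional parameters. -/
theorem definable_fiber {A B : Set M} {α β : Type} {D : Set (α ⊕ β → M)} (hD : A.Definable L D)
    (hAB : A ⊆ B) {b : β → M} (hb : Set.range b ⊆ B) :
    B.Definable L {x : α → M | Sum.elim x b ∈ D} := by
  obtain ⟨φ, rfl⟩ := Set.definable_iff_exists_formula_sum.1 hD
  refine Set.definable_iff_exists_formula_sum.2
    ⟨φ.relabel (Sum.elim (fun a : A => Sum.inl ⟨(a : M), hAB a.2⟩)
      (Sum.elim Sum.inr fun j => Sum.inl ⟨b j, hb ⟨j, rfl⟩⟩)), ?_⟩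
  ext x
  simp only [Set.mem_ofPred_eq, FirstOrder.Language.Formula.realize_relabel]
  refine iff_of_eq (congrArg _ ?_)
  funext i
  rcases i with i | i | i <;> rfl

theorem exists_definable_fiber {A : Set M} {α β : Type} {b : β → M} {E : Set (α → M)}
    (hE : (A ∪ Set.range b).Definable L E) :
    ∃ D : Set (α ⊕ β → M), A.Definable L D ∧ E = {x | Sum.elim x b ∈ D} := by
  classical
  obtain ⟨φ, rfl⟩ := Set.definable_iff_exists_formula_sum.1 hE
  have hc : ∀ c : ↥(A ∪ Set.range b), ∃ i : A ⊕ β, Sum.elim (↑) b i = (c : M) := by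
    rintro ⟨c, hc | ⟨j, rfl⟩⟩
    exacts [⟨Sum.inl ⟨c, hc⟩, rfl⟩, ⟨Sum.inr j, rfl⟩]
  choose f hf using hc
  refine ⟨_, Set.definable_iff_exists_formula_sum.2
    ⟨φ.relabel (Sum.elim (Sum.map id Sum.inr ∘ f) (Sum.inr ∘ Sum.inl)), rfl⟩, ?_⟩
  ext x
  simp only [Set.mem_ofPred_eq, FirstOrder.Language.Formula.realize_relabel]
  refine iff_of_eq (congrArg _ ?_)
  funext i
  rcases i with i | i
  · simp only [Sum.elim_inl, Function.comp, ← hf i]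
    cases f i <;> rfl
  · rfl

theorem IsSaturated.exists_mem_of_definable (hM : IsSaturated L M) {A : Set M} (hA : #A < #M)
    {n : ℕ} (S : Set (Set (Fin n → M))) (hS : ∀ s ∈ S, A.Definable L s)
    (hfin : ∀ S₀ : Finset (Set (Fin n → M)), (S₀ : Set (Set (Fin n → M))) ⊆ S →
      ∃ a, ∀ s ∈ S₀, a ∈ s) : ∃ a, ∀ s ∈ S, a ∈ s := by
  classical
  obtain ⟨a, ha⟩ := hM A hA n {φ | Set.ofPred φ.Realize ∈ S} fun S₀ hS₀ => by
    obtain ⟨a, ha⟩ := hfin (S₀.image fun φ => Set.ofPred φ.Realize) (by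
      intro s hs
      obtain ⟨φ, hφ, rfl⟩ := Finset.mem_image.1 (Finset.mem_coe.1 hs)
      exact hS₀ hφ)
    exact ⟨a, fun φ hφ => ha _ (Finset.mem_image_of_mem _ hφ)⟩
  refine ⟨a, fun s hs => ?_⟩
  obtain ⟨φ, rfl⟩ := hS s hs
  exact ha φ hs

theorem IsMonster.aleph0_lt (hM : IsMonster L M) : ℵ₀ < #M := by
  have h := (Cardinal.lift_le.{w}.2 (le_max_left ℵ₀ L.card)).trans_lt hM.large
  rw [Cardinal.lift_aleph0, ← Cardinal.lift_aleph0.{max u v}] at h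
  exact Cardinal.lift_lt.1 h

theorem IsMonster.union_lt (hM : IsMonster L M) {A B : Set M} (hA : #A < #M) (hB : B.Finite) :
    #(A ∪ B : Set M) < #M :=
  (Cardinal.mk_union_le A B).trans_lt (Cardinal.add_lt_of_lt hM.aleph0_lt.le hA
    ((Cardinal.lt_aleph0_iff_set_finite.2 hB).trans hM.aleph0_lt))

variable [Nonempty M]

theorem tp_eq_iff {A : Set M} {α : Type} {a b : α → M} :
    tp L A a = tp L A b ↔ ∀ D : Set (α → M), A.Definable L D → (a ∈ D ↔ b ∈ D) := by
  constructor
  · rintro h D ⟨φ, rfl⟩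
    have h₁ : FirstOrder.Language.Formula.equivSentence φ ∈ tp L A a ↔
        FirstOrder.Language.Formula.equivSentence φ ∈ tp L A b := by rw [h]
    simp only [tp, FirstOrder.Language.Theory.CompleteType.formula_mem_typeOf] at h₁
    exact h₁
  · intro h
    refine SetLike.ext fun φ => ?_
    simp only [tp, FirstOrder.Language.Theory.CompleteType.mem_typeOf]
    exact h _ ⟨_, rfl⟩

theorem tp_comp {A : Set M} {α β : Type} (f : α → β) {a b : β → M}
    (h : tp L A a = tp L A b) : tp L A (a ∘ f) = tp L A (b ∘ f) :=
  tp_eq_iff.2 fun _ hD => tp_eq_iff.1 h _ (hD.preimage_comp f)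

theorem tp_inl {A : Set M} {α β : Type} {a a' : α → M} {b b' : β → M}
    (h : tp L A (Sum.elim a b) = tp L A (Sum.elim a' b')) : tp L A a = tp L A a' :=
  tp_comp Sum.inl h

theorem tp_inr {A : Set M} {α β : Type} {a a' : α → M} {b b' : β → M}
    (h : tp L A (Sum.elim a b) = tp L A (Sum.elim a' b')) : tp L A b = tp L A b' :=
  tp_comp Sum.inr h

theorem tp_swap {A : Set M} {α β : Type} {a a' : α → M} {b b' : β → M}
    (h : tp L A (Sum.elim a b) = tp L A (Sum.elim a' b')) :
    tp L A (Sum.elim b a) = tp L A (Sum.elim b' a') := by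
  have := tp_comp (Sum.elim Sum.inr Sum.inl : β ⊕ α → α ⊕ β) h
  simpa only [Sum.comp_elim, Sum.elim_comp_inl, Sum.elim_comp_inr] using this

theorem tp_diag {A : Set M} {α : Type} {a b c : α → M}
    (h : tp L A (Sum.elim a b) = tp L A (Sum.elim c c)) : a = b := by
  have hD : A.Definable L {x : α ⊕ α → M | ∀ i, x (Sum.inl i) = x (Sum.inr i)} → a = b :=
    fun hD => funext ((tp_eq_iff.1 h _ hD).2 fun _ => rfl)
  by_contra hne
  obtain ⟨i, hi⟩ := Function.ne_iff.1 hne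
  have hi' : A.Definable L {x : α ⊕ α → M | x (Sum.inl i) = x (Sum.inr i)} :=
    ⟨(FirstOrder.Language.Term.var (Sum.inl i)).equal (FirstOrder.Language.Term.var (Sum.inr i)), by
      ext; simp [FirstOrder.Language.Formula.realize_equal]⟩
  exact hi ((tp_eq_iff.1 h _ hi').2 rfl)

theorem tp_union_range_eq_iff {A : Set M} {α β : Type} {a a' : α → M} {b : β → M} :
    tp L (A ∪ Set.range b) a = tp L (A ∪ Set.range b) a' ↔
      tp L A (Sum.elim a b) = tp L A (Sum.elim a' b) := by
  simp only [tp_eq_iff]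
  constructor
  · intro h D hD
    exact h _ (definable_fiber hD Set.subset_union_left Set.subset_union_right)
  · intro h E hE
    obtain ⟨D, hD, rfl⟩ := exists_definable_fiber hE
    exact h D hD

/-! ### Saturation -/

/-- A family of definable sets closed under intersection and without the empty set has a
common point. -/
theorem IsSaturated.exists_mem_of_inter_closed (hM : IsSaturated L M) {A : Set M} (hA : #A < #M)
    {n : ℕ} (S : Set (Set (Fin n → M))) (hS : ∀ s ∈ S, A.Definable L s)
    (hne : ∀ s ∈ S, s.Nonempty) (hinter : ∀ s ∈ S, ∀ t ∈ S, s ∩ t ∈ S) :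
    ∃ a, ∀ s ∈ S, a ∈ s := by
  classical
  refine hM.exists_mem_of_definable hA S hS fun S₀ hS₀ => ?_
  rcases S₀.eq_empty_or_nonempty with rfl | hS₀ne
  · exact ⟨fun _ => Classical.arbitrary M, by simp⟩
  have key : ∃ t ∈ S, ∀ s ∈ S₀, t ⊆ s := by
    induction hS₀ne using Finset.Nonempty.cons_induction with
    | singleton s => exact ⟨s, hS₀ (by simp), by simp⟩
    | cons s T hs hT ih =>
      obtain ⟨t, ht, h⟩ := ih fun x hx => hS₀ (by simp at hx ⊢; exact Or.inr hx)
      refine ⟨s ∩ t, hinter _ (hS₀ (by simp)) _ ht, fun x hx => ?_⟩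
      rcases Finset.mem_cons.1 hx with rfl | hx
      exacts [Set.inter_subset_left, Set.inter_subset_right.trans (h x hx)]
  obtain ⟨t, ht, h⟩ := key
  obtain ⟨a, ha⟩ := hne t ht
  exact ⟨a, fun s hs => h s hs ha⟩

/-- Homogeneity of the monster model. -/
theorem IsMonster.exists_tp_eq (hM : IsMonster L M) {A : Set M} (hA : #A < #M) {α : Type}
    [Finite α] {n : ℕ} {a a' : α → M} (h : tp L A a = tp L A a') (b : Fin n → M) :
    ∃ b' : Fin n → M, tp L A (Sum.elim b a) = tp L A (Sum.elim b' a') := by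
  obtain ⟨b', hb'⟩ := hM.saturated.exists_mem_of_inter_closed
    (hM.union_lt hA (Set.finite_range a'))
    {E | ∃ D : Set (Fin n ⊕ α → M), A.Definable L D ∧ Sum.elim b a ∈ D ∧
      E = {x | Sum.elim x a' ∈ D}}
    (by
      rintro _ ⟨D, hD, -, rfl⟩
      exact definable_fiber hD Set.subset_union_left Set.subset_union_right)
    (by
      rintro _ ⟨D, hD, hab, rfl⟩
      have hP := (hD.preimage_comp (Sum.elim Sum.inr Sum.inl : Fin n ⊕ α → α ⊕ Fin n))
      have := (tp_eq_iff.1 h _ hP.exists_of_finite).1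
        ⟨b, by simpa only [Set.mem_preimage, Sum.comp_elim, Sum.elim_comp_inl,
          Sum.elim_comp_inr] using hab⟩
      obtain ⟨x, hx⟩ := this
      exact ⟨x, by simpa only [Set.mem_preimage, Sum.comp_elim, Sum.elim_comp_inl, Sum.elim_comp_inr,
        Set.mem_ofPred_eq] using hx⟩)
    (by
      rintro _ ⟨D, hD, hab, rfl⟩ _ ⟨D', hD', hab', rfl⟩
      exact ⟨D ∩ D', hD.inter hD', ⟨hab, hab'⟩, rfl⟩)
  refine ⟨b', tp_eq_iff.2 fun D hD => ⟨fun hb => hb' _ ⟨D, hD, hb, rfl⟩, fun hb => ?_⟩⟩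
  by_contra hn
  exact hb' _ ⟨Dᶜ, hD.compl, hn, rfl⟩ hb

/-! ### Eventual sets and generic realizations -/

section Generic

variable {A : Set M} {α β : Type}

theorem mem_locus_of_tp_eq {p : TypeOver L A α} {a a' : α → M} (ha : a ∈ locus p)
    (h : tp L A a = tp L A a') : a' ∈ locus p :=
  h.symm.trans ha

theorem tp_eq_of_mem_locus {p : TypeOver L A α} {a a' : α → M} (ha : a ∈ locus p)
    (ha' : a' ∈ locus p) : tp L A a = tp L A a' :=
  Eq.trans ha (Eq.symm ha')

theorem Definable.relDefinable {B : Set M} {p : TypeOver L A α} {E : Set (α → M)}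
    (hE : B.Definable L E) : RelDefinable p {x : locus p | (x : α → M) ∈ E} :=
  ⟨E, hE.mono (Set.subset_univ _), fun _ => Iff.rfl⟩

theorem trichotomy {X : Type*} {lt : X → X → Prop} (h : IsStrictTotalOrder X lt) (a b : X) :
    lt a b ∨ a = b ∨ lt b a := by
  by_contra! hn
  exact hn.2.1 (h.trichotomous a b hn.1 hn.2.2)

theorem leftEventual_iff {X : Type*} {lt : X → X → Prop} (h : IsStrictTotalOrder X lt)
    {D : Set X} : LeftEventual lt D ↔ ∃ a, ∀ x, ¬ lt a x → x ∈ D := by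
  constructor
  · rintro ⟨I, hI, ⟨a, ha⟩, hdown⟩
    refine ⟨a, fun x hx => hI ?_⟩
    rcases trichotomy h x a with hxa | rfl | hax
    exacts [hdown a ha x hxa, ha, absurd hax hx]
  · rintro ⟨a, ha⟩
    refine ⟨{x | ¬ lt a x}, ha, ⟨a, h.irrefl a⟩, fun x hx y hyx hay => hx (h.trans _ _ _ hay hyx)⟩

theorem LeftEventual.nonempty {X : Type*} {lt : X → X → Prop} {D : Set X}
    (h : LeftEventual lt D) : D.Nonempty :=
  let ⟨_, hI, hne, _⟩ := h
  hne.mono hI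

theorem LeftEventual.inter {X : Type*} {lt : X → X → Prop} (h : IsStrictTotalOrder X lt)
    {D E : Set X} (hD : LeftEventual lt D) (hE : LeftEventual lt E) : LeftEventual lt (D ∩ E) := by
  rw [leftEventual_iff h] at *
  obtain ⟨a, ha⟩ := hD
  obtain ⟨b, hb⟩ := hE
  rcases trichotomy h a b with hab | rfl | hba
  · exact ⟨a, fun x hx => ⟨ha x hx, hb x fun hbx => hx (h.trans _ _ _ hab hbx)⟩⟩
  · exact ⟨a, fun x hx => ⟨ha x hx, hb x hx⟩⟩
  · exact ⟨b, fun x hx => ⟨ha x fun hax => hx (h.trans _ _ _ hba hax), hb x hx⟩⟩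

namespace NonalgSOPair

variable (P : NonalgSOPair L A)

theorem nonempty_locus : Nonempty (locus P.type) :=
  P.nonalgebraic.nonempty.to_subtype

theorem eq_of_not_lt_of_not_lt {a b : locus P.type} (hab : ¬ P.lt a b) (hba : ¬ P.lt b a) :
    a = b :=
  P.isSO.linear.trichotomous a b hab hba

theorem lt_iff_of_tp_eq {a b a' b' : locus P.type}
    (h : tp L A (Sum.elim (a : Fin P.n → M) (b : Fin P.n → M)) =
      tp L A (Sum.elim (a' : Fin P.n → M) (b' : Fin P.n → M))) : P.lt a b ↔ P.lt a' b' := by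
  obtain ⟨D, hD, hlt⟩ := P.isSO.definable
  rw [hlt, hlt]
  exact tp_eq_iff.1 h D hD

theorem leftEventual_or {B : Set M} {E : Set (Fin P.n → M)} (hE : B.Definable L E) :
    LeftEventual P.lt {x : locus P.type | (x : Fin P.n → M) ∈ E} ∨
      LeftEventual P.lt {x : locus P.type | (x : Fin P.n → M) ∈ Eᶜ} :=
  (P.isSO.left _ (Definable.relDefinable hE)).or

theorem leftGeneric_iff {B : Set M} {a : Fin P.n → M} :
    P.LeftGeneric B a ↔ ∀ E : Set (Fin P.n → M), (A ∪ B).Definable L E →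
      LeftEventual P.lt {x : locus P.type | (x : Fin P.n → M) ∈ E} → a ∈ E := by
  constructor
  · rintro h _ ⟨φ, rfl⟩ hE
    exact h φ hE
  · intro h φ hφ
    exact h _ ⟨φ, rfl⟩ hφ

variable {P}

theorem LeftGeneric.mem_locus {B : Set M} {a : Fin P.n → M} (h : P.LeftGeneric B a) :
    a ∈ locus P.type := by
  obtain ⟨c, hc⟩ := P.nonempty_locus
  refine mem_locus_of_tp_eq hc (tp_eq_iff.2 fun D hD => ?_)
  have key : ∀ D : Set (Fin P.n → M), A.Definable L D → c ∈ D → a ∈ D := by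
    intro D hD hcD
    refine P.leftGeneric_iff.1 h D (hD.mono Set.subset_union_left) ?_
    refine (leftEventual_iff P.isSO.linear).2 ⟨⟨c, hc⟩, fun x _ => ?_⟩
    exact (tp_eq_iff.1 (tp_eq_of_mem_locus hc x.2) D hD).1 hcD
  exact ⟨key D hD, fun ha => by_contra fun hn => key Dᶜ hD.compl hn ha⟩

theorem RightGeneric.mem_locus {B : Set M} {a : Fin P.n → M} (h : P.RightGeneric B a) :
    a ∈ locus P.type :=
  LeftGeneric.mem_locus (P := P.reverse) h

theorem LeftGeneric.mono {B B' : Set M} {a : Fin P.n → M} (h : P.LeftGeneric B' a)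
    (hB : B ⊆ B') : P.LeftGeneric B a :=
  P.leftGeneric_iff.2 fun E hE => P.leftGeneric_iff.1 h E
    (hE.mono (Set.union_subset_union_right A hB))

theorem LeftGeneric.tp_eq {B : Set M} {a a' : Fin P.n → M} (h : P.LeftGeneric B a)
    (h' : P.LeftGeneric B a') : tp L (A ∪ B) a = tp L (A ∪ B) a' := by
  have key : ∀ {a a' : Fin P.n → M}, P.LeftGeneric B a → P.LeftGeneric B a' →
      ∀ E : Set (Fin P.n → M), (A ∪ B).Definable L E → a ∈ E → a' ∈ E := by
    intro a a' h h' E hE haE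
    rcases P.leftEventual_or hE with hl | hl
    · exact P.leftGeneric_iff.1 h' E hE hl
    · exact absurd haE (P.leftGeneric_iff.1 h _ hE.compl hl)
  exact tp_eq_iff.2 fun E hE => ⟨key h h' E hE, key h' h E hE⟩

variable (P)

theorem exists_leftGeneric (hM : IsMonster L M) (hA : #A < #M) {B : Set M} (hB : B.Finite) :
    ∃ a, P.LeftGeneric B a := by
  obtain ⟨a, ha⟩ := hM.saturated.exists_mem_of_inter_closed (hM.union_lt hA hB)
    {E | (A ∪ B).Definable L E ∧ LeftEventual P.lt {x : locus P.type | (x : Fin P.n → M) ∈ E}}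
    (fun E hE => hE.1)
    (fun E hE => let ⟨x, hx⟩ := hE.2.nonempty; ⟨x, hx⟩)
    (fun E hE E' hE' => ⟨hE.1.inter hE'.1, hE.2.inter P.isSO.linear hE'.2⟩)
  exact ⟨a, P.leftGeneric_iff.2 fun E hE hl => ha E ⟨hE, hl⟩⟩

theorem exists_rightGeneric (hM : IsMonster L M) (hA : #A < #M) {B : Set M} (hB : B.Finite) :
    ∃ a, P.RightGeneric B a :=
  P.reverse.exists_leftGeneric hM hA hB

theorem exists_lt (hM : IsMonster L M) (hA : #A < #M) (a : locus P.type) : ∃ b, P.lt b a := by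
  by_contra! hmin
  obtain ⟨a', ha', hne⟩ := P.nonalgebraic.exists_notMem_finite (Set.finite_singleton a.1)
  obtain ⟨c, hc⟩ := hM.exists_tp_eq hA (tp_eq_of_mem_locus ha' a.2) (a : Fin P.n → M)
  have hcl : c ∈ locus P.type := mem_locus_of_tp_eq a.2 (tp_inl hc)
  have hlt : P.lt a ⟨a', ha'⟩ := by
    by_contra hn
    exact hne (congrArg Subtype.val (P.eq_of_not_lt_of_not_lt (hmin ⟨a', ha'⟩) hn))
  exact hmin ⟨c, hcl⟩ ((P.lt_iff_of_tp_eq (a' := ⟨c, hcl⟩) (b' := a) hc).1 hlt)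

variable {P}

theorem definable_lt (a : locus P.type) : ∃ E : Set (Fin P.n → M),
    (A ∪ Set.range (a : Fin P.n → M)).Definable L E ∧ ∀ x : locus P.type, P.lt x a ↔ x.1 ∈ E := by
  obtain ⟨D, hD, hlt⟩ := P.isSO.definable
  exact ⟨_, definable_fiber hD Set.subset_union_left Set.subset_union_right, fun x => hlt x a⟩

theorem LeftGeneric.lt (hM : IsMonster L M) (hA : #A < #M) {B : Set M} {a b : locus P.type}
    (h : P.LeftGeneric B a) (hb : Set.range (b : Fin P.n → M) ⊆ B) : P.lt a b := by
  obtain ⟨E, hE, hlt⟩ := definable_lt b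
  refine (hlt a).2 (P.leftGeneric_iff.1 h E (hE.mono (Set.union_subset_union_right A hb)) ?_)
  obtain ⟨c, hc⟩ := P.exists_lt hM hA b
  refine (leftEventual_iff P.isSO.linear).2 ⟨c, fun x hx => (hlt x).1 ?_⟩
  by_contra hn
  exact P.isSO.linear.irrefl c
    (P.isSO.linear.trans _ _ _ hc (by
      by_contra hbc
      have hxb : ¬ P.lt b x := fun hbx => hx (P.isSO.linear.trans _ _ _ hc hbx)
      have := P.eq_of_not_lt_of_not_lt hn hxb
      exact hx (this ▸ hc)))

theorem leftGeneric_range_iff {b : β → M} {a : Fin P.n → M} :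
    P.LeftGeneric (Set.range b) a ↔ ∀ D : Set (Fin P.n ⊕ β → M), A.Definable L D →
      LeftEventual P.lt {x : locus P.type | Sum.elim (x : Fin P.n → M) b ∈ D} →
        Sum.elim a b ∈ D := by
  rw [leftGeneric_iff]
  constructor
  · intro h D hD
    exact h _ (definable_fiber hD Set.subset_union_left Set.subset_union_right)
  · intro h E hE
    obtain ⟨D, hD, rfl⟩ := exists_definable_fiber hE
    exact h D hD

variable [Finite β]

theorem leftEventual_of_tp_eq (hM : IsMonster L M) (hA : #A < #M) {D : Set (Fin P.n ⊕ β → M)}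
    (hD : A.Definable L D) {b b' : β → M} (h : tp L A b = tp L A b')
    (hl : LeftEventual P.lt {x : locus P.type | Sum.elim (x : Fin P.n → M) b ∈ D}) :
    LeftEventual P.lt {x : locus P.type | Sum.elim (x : Fin P.n → M) b' ∈ D} := by
  rw [leftEventual_iff P.isSO.linear] at *
  obtain ⟨a, ha⟩ := hl
  obtain ⟨a', ha'⟩ := hM.exists_tp_eq hA h (a : Fin P.n → M)
  refine ⟨⟨a', mem_locus_of_tp_eq a.2 (tp_inl ha')⟩, fun x' hx' => ?_⟩
  obtain ⟨x, hx⟩ := hM.exists_tp_eq hA ha'.symm (x' : Fin P.n → M)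
  have hxl : x ∈ locus P.type := mem_locus_of_tp_eq x'.2 (tp_inl hx)
  have h₁ := tp_comp (Sum.elim (Sum.inr ∘ Sum.inl) Sum.inl : Fin P.n ⊕ Fin P.n → _) hx
  have h₂ := tp_comp (Sum.elim Sum.inl (Sum.inr ∘ Sum.inr) : Fin P.n ⊕ β → _) hx
  simp only [Sum.comp_elim, Sum.elim_comp_inl, Sum.elim_comp_inr, ← Function.comp_assoc] at h₁ h₂
  refine (tp_eq_iff.1 h₂ D hD).2 (ha ⟨x, hxl⟩ fun hlt => hx' ?_)
  exact (P.lt_iff_of_tp_eq (a' := a) (b' := ⟨x, hxl⟩) h₁).2 hlt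

theorem LeftGeneric.of_tp_eq (hM : IsMonster L M) (hA : #A < #M) {a a' : Fin P.n → M}
    {b b' : β → M} (hg : P.LeftGeneric (Set.range b) a)
    (h : tp L A (Sum.elim a b) = tp L A (Sum.elim a' b')) :
    P.LeftGeneric (Set.range b') a' :=
  leftGeneric_range_iff.2 fun D hD hl => (tp_eq_iff.1 h D hD).1
    (leftGeneric_range_iff.1 hg D hD (leftEventual_of_tp_eq hM hA hD (tp_inr h).symm hl))

theorem RightGeneric.of_tp_eq (hM : IsMonster L M) (hA : #A < #M) {a a' : Fin P.n → M}
    {b b' : β → M} (hg : P.RightGeneric (Set.range b) a)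
    (h : tp L A (Sum.elim a b) = tp L A (Sum.elim a' b')) :
    P.RightGeneric (Set.range b') a' :=
  LeftGeneric.of_tp_eq (P := P.reverse) hM hA hg h

theorem LeftGeneric.tp_elim_eq (hM : IsMonster L M) (hA : #A < #M) {a a' : Fin P.n → M}
    {b b' : β → M} (hg : P.LeftGeneric (Set.range b) a) (hg' : P.LeftGeneric (Set.range b') a')
    (h : tp L A b = tp L A b') : tp L A (Sum.elim a b) = tp L A (Sum.elim a' b') := by
  obtain ⟨c, hc⟩ := hM.exists_tp_eq hA h a
  exact hc.trans (tp_union_range_eq_iff.1 ((hg.of_tp_eq hM hA hc).tp_eq hg'))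

theorem RightGeneric.tp_elim_eq (hM : IsMonster L M) (hA : #A < #M) {a a' : Fin P.n → M}
    {b b' : β → M} (hg : P.RightGeneric (Set.range b) a) (hg' : P.RightGeneric (Set.range b') a')
    (h : tp L A b = tp L A b') : tp L A (Sum.elim a b) = tp L A (Sum.elim a' b') :=
  LeftGeneric.tp_elim_eq (P := P.reverse) hM hA hg hg' h

/-- The left generic realizations over a tuple form an initial part. -/
theorem LeftGeneric.of_lt (hM : IsMonster L M) (hA : #A < #M) {a a' : locus P.type} {b : β → M}
    (hg : P.LeftGeneric (Set.range b) a) (hlt : P.lt a' a) : P.LeftGeneric (Set.range b) a' := by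
  refine leftGeneric_range_iff.2 fun D hD hl => ?_
  obtain ⟨e, he⟩ := (leftEventual_iff P.isSO.linear).1 hl
  obtain ⟨c, hc⟩ := P.exists_leftGeneric hM hA
    ((Set.finite_range b).union (Set.finite_range (e : Fin P.n → M)))
  have hce : P.lt ⟨c, hc.mem_locus⟩ e :=
    LeftGeneric.lt hM hA (a := ⟨c, hc.mem_locus⟩) hc Set.subset_union_right
  have hac := hg.tp_elim_eq hM hA (hc.mono Set.subset_union_left) rfl
  obtain ⟨d, hd⟩ := hM.exists_tp_eq hA hac (a' : Fin P.n → M)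
  have hdl : d ∈ locus P.type := mem_locus_of_tp_eq a'.2 (tp_inl hd)
  have h₁ := tp_comp (Sum.elim Sum.inl (Sum.inr ∘ Sum.inl) : Fin P.n ⊕ Fin P.n → _) hd
  have h₂ := tp_comp (Sum.elim Sum.inl (Sum.inr ∘ Sum.inr) : Fin P.n ⊕ β → _) hd
  simp only [Sum.comp_elim, Sum.elim_comp_inl, Sum.elim_comp_inr, ← Function.comp_assoc] at h₁ h₂
  have hdc := (P.lt_iff_of_tp_eq (a' := ⟨d, hdl⟩) (b' := ⟨c, hc.mem_locus⟩) h₁).1 hlt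
  refine (tp_eq_iff.1 h₂ D hD).2 (he ⟨d, hdl⟩ fun hed => P.isSO.linear.irrefl e ?_)
  exact P.isSO.linear.trans _ _ _ hed (P.isSO.linear.trans _ _ _ hdc hce)

theorem RightGeneric.of_lt (hM : IsMonster L M) (hA : #A < #M) {a a' : locus P.type} {b : β → M}
    (hg : P.RightGeneric (Set.range b) a) (hlt : P.lt a a') : P.RightGeneric (Set.range b) a' :=
  LeftGeneric.of_lt (P := P.reverse) hM hA hg hlt

theorem lt_of_leftGeneric_of_not (hM : IsMonster L M) (hA : #A < #M) {a c : locus P.type}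
    {b : β → M} (ha : P.LeftGeneric (Set.range b) a) (hc : ¬ P.LeftGeneric (Set.range b) c) :
    P.lt a c := by
  by_contra hn
  rcases trichotomy P.isSO.linear a c with h | rfl | h
  exacts [hn h, hc ha, hc (ha.of_lt hM hA h)]

theorem lt_of_rightGeneric_of_not (hM : IsMonster L M) (hA : #A < #M) {a c : locus P.type}
    {b : β → M} (ha : P.RightGeneric (Set.range b) a) (hc : ¬ P.RightGeneric (Set.range b) c) :
    P.lt c a :=
  lt_of_leftGeneric_of_not (P := P.reverse) hM hA ha hc

/-- If left and right generic realizations over `b` are not separated, then `P.type` is weakly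
orthogonal to `tp(b / A)`. -/
theorem not_leftGeneric_and_rightGeneric (hM : IsMonster L M) (hA : #A < #M)
    {q : TypeOver L A β} (h : ¬ WeaklyOrthogonal P.type q) {b : β → M} (hb : b ∈ locus q)
    {a : Fin P.n → M} (hl : P.LeftGeneric (Set.range b) a)
    (hr : P.RightGeneric (Set.range b) a) : False := by
  have key : ∀ a' ∈ locus P.type, ∀ b' ∈ locus q,
      tp L A (Sum.elim a' b') = tp L A (Sum.elim a b) := by
    intro a' ha' b' hb'
    have hbb := tp_eq_of_mem_locus hb hb'
    obtain ⟨c, hc⟩ := hM.exists_tp_eq hA hbb a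
    have hlc := hl.of_tp_eq hM hA hc
    have hrc := hr.of_tp_eq hM hA hc
    rcases trichotomy P.isSO.linear ⟨a', ha'⟩ ⟨c, hlc.mem_locus⟩ with hlt | heq | hlt
    · exact (hl.tp_elim_eq hM hA (LeftGeneric.of_lt (a := ⟨c, hlc.mem_locus⟩) hM hA hlc hlt)
        hbb).symm
    · obtain rfl : a' = c := congrArg Subtype.val heq
      exact hc.symm
    · exact (hr.tp_elim_eq hM hA (RightGeneric.of_lt (a := ⟨c, hlc.mem_locus⟩) hM hA hrc hlt)
        hbb).symm
  exact h fun a₁ ha₁ b₁ hb₁ a₂ ha₂ b₂ hb₂ => (key a₁ ha₁ b₁ hb₁).trans (key a₂ ha₂ b₂ hb₂).symm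

end NonalgSOPair

end Generic

/-! ### Orthogonality -/

section Orthogonality

variable {A : Set M}

theorem WeaklyOrthogonal.symm {α β : Type} {p : TypeOver L A α} {q : TypeOver L A β}
    (h : WeaklyOrthogonal p q) : WeaklyOrthogonal q p :=
  fun b hb a ha b' hb' a' ha' => tp_swap (h a ha b hb a' ha' b' hb')

theorem not_weaklyOrthogonal_self {α : Type} {p : TypeOver L A α} (hp : (locus p).Infinite) :
    ¬ WeaklyOrthogonal p p := by
  intro h
  obtain ⟨a, ha⟩ := hp.nonempty
  obtain ⟨b, hb, hne⟩ := hp.exists_notMem_finite (Set.finite_singleton a)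
  exact hne (tp_diag (h b hb a ha a ha a ha))

namespace NonalgSOPair

variable {P Q R : NonalgSOPair L A}

/-- There is no invariant pairwise intersecting family of subsets of `p(M)` that are bounded on
both sides. -/
theorem not_bounded_of_intersecting (hM : IsMonster L M) (hA : #A < #M) {m : ℕ}
    {r : TypeOver L A (Fin m)} (W : (Fin P.n → M) → (Fin m → M) → Prop)
    (hW : ∀ {x x' z z'}, tp L A (Sum.elim x z) = tp L A (Sum.elim x' z') → W x z → W x' z')
    (hint : ∀ z ∈ locus r, ∀ z' ∈ locus r, ∃ x : locus P.type, W x z ∧ W x z')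
    {z : Fin m → M} (hz : z ∈ locus r) {a b : locus P.type}
    (ha : ∀ x : locus P.type, W x z → P.lt a x) (hb : ∀ x : locus P.type, W x z → P.lt x b) :
    False := by
  obtain ⟨z', hz'⟩ := hM.exists_tp_eq hA (tp_eq_of_mem_locus a.2 b.2) z
  replace hz' := tp_swap hz'
  have hz'r : z' ∈ locus r := mem_locus_of_tp_eq hz (tp_inr hz')
  obtain ⟨x', hxz, hxz'⟩ := hint z hz z' hz'r
  obtain ⟨x, hx⟩ := hM.exists_tp_eq hA hz'.symm (x' : Fin P.n → M)
  have hxl : x ∈ locus P.type := mem_locus_of_tp_eq x'.2 (tp_inl hx)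
  have h₁ := tp_comp (Sum.elim (Sum.inr ∘ Sum.inl) Sum.inl : Fin P.n ⊕ Fin P.n → _) hx
  have h₂ := tp_comp (Sum.elim Sum.inl (Sum.inr ∘ Sum.inr) : Fin P.n ⊕ Fin m → _) hx
  simp only [Sum.comp_elim, Sum.elim_comp_inl, Sum.elim_comp_inr, ← Function.comp_assoc] at h₁ h₂
  have hbx := (P.lt_iff_of_tp_eq (a' := a) (b' := ⟨x, hxl⟩) h₁).2 (ha ⟨x, hxl⟩ (hW h₂ hxz'))
  exact P.isSO.linear.irrefl b (P.isSO.linear.trans _ _ _ hbx (hb x' hxz))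

/-- `F` is a relation between `p(M)` and `q(M)` that is invariant and whose fibers in `q(M)` are
final parts. -/
structure IsFinalRel (P Q : NonalgSOPair L A) (F : (Fin P.n → M) → (Fin Q.n → M) → Prop) :
    Prop where
  invariant : ∀ {a a' b b'}, tp L A (Sum.elim a b) = tp L A (Sum.elim a' b') → F a b → F a' b'
  final : ∀ (a : locus P.type) (b b' : locus Q.type), F a b → Q.lt b b' → F a b'

theorem IsFinalRel.not_of_nonempty (hM : IsMonster L M) (hA : #A < #M)
    {F : (Fin P.n → M) → (Fin Q.n → M) → Prop} (hF : IsFinalRel P Q F)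
    (hne : ∃ (a : locus P.type) (b : locus Q.type), F a b) {a c : Fin P.n → M} {b : locus Q.type}
    (ha : P.LeftGeneric (Set.range (b : Fin Q.n → M)) a)
    (hc : P.RightGeneric (Set.range (b : Fin Q.n → M)) c) (hab : ¬ F a b) (hcb : ¬ F c b) :
    False := by
  have hex : ∀ z ∈ locus Q.type, ∃ x : locus P.type, F x z := by
    intro z hz
    obtain ⟨x, y, hxy⟩ := hne
    obtain ⟨x', hx'⟩ := hM.exists_tp_eq hA (tp_eq_of_mem_locus y.2 hz) (x : Fin P.n → M)
    exact ⟨⟨x', mem_locus_of_tp_eq x.2 (tp_inl hx')⟩, hF.invariant hx' hxy⟩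
  refine not_bounded_of_intersecting (P := P) (r := Q.type) hM hA F hF.invariant ?_ b.2
    (a := ⟨a, ha.mem_locus⟩) (b := ⟨c, hc.mem_locus⟩) ?_ ?_
  · intro z hz z' hz'
    rcases trichotomy Q.isSO.linear ⟨z, hz⟩ ⟨z', hz'⟩ with h | h | h
    · obtain ⟨x, hx⟩ := hex z hz
      exact ⟨x, hx, hF.final x ⟨z, hz⟩ ⟨z', hz'⟩ hx h⟩
    · obtain ⟨x, hx⟩ := hex z hz
      obtain rfl : z = z' := congrArg Subtype.val h
      exact ⟨x, hx, hx⟩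
    · obtain ⟨x, hx⟩ := hex z' hz'
      exact ⟨x, hF.final x ⟨z', hz'⟩ ⟨z, hz⟩ hx h, hx⟩
  · intro x hx
    refine lt_of_leftGeneric_of_not (a := ⟨a, ha.mem_locus⟩) hM hA ha fun hl => hab ?_
    exact hF.invariant (hl.tp_elim_eq hM hA ha rfl) hx
  · intro x hx
    refine lt_of_rightGeneric_of_not (a := ⟨c, hc.mem_locus⟩) hM hA hc fun hl => hcb ?_
    exact hF.invariant (hl.tp_elim_eq hM hA hc rfl) hx

/-- A nontrivial invariant family of final parts separates left from right generic elements. -/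
theorem IsFinalRel.separates (hM : IsMonster L M) (hA : #A < #M)
    {F : (Fin P.n → M) → (Fin Q.n → M) → Prop} (hF : IsFinalRel P Q F)
    (hne : ∃ (a : locus P.type) (b : locus Q.type), F a b)
    (hne' : ∃ (a : locus P.type) (b : locus Q.type), ¬ F a b) :
    (∀ a, ∀ b ∈ locus Q.type, (P.LeftGeneric (Set.range b) a → F a b) ∧
      (P.RightGeneric (Set.range b) a → ¬ F a b)) ∨
    (∀ a, ∀ b ∈ locus Q.type, (P.LeftGeneric (Set.range b) a → ¬ F a b) ∧
      (P.RightGeneric (Set.range b) a → F a b)) := by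
  obtain ⟨b₀⟩ := Q.nonempty_locus
  obtain ⟨l, hl⟩ := P.exists_leftGeneric hM hA (Set.finite_range (b₀ : Fin Q.n → M))
  obtain ⟨r, hr⟩ := P.exists_rightGeneric hM hA (Set.finite_range (b₀ : Fin Q.n → M))
  have hL : ∀ {a b}, b ∈ locus Q.type → P.LeftGeneric (Set.range b) a → (F a b ↔ F l b₀) := by
    intro a b hb ha
    have := ha.tp_elim_eq hM hA hl (tp_eq_of_mem_locus hb b₀.2)
    exact ⟨hF.invariant this, hF.invariant this.symm⟩
  have hR : ∀ {a b}, b ∈ locus Q.type → P.RightGeneric (Set.range b) a → (F a b ↔ F r b₀) := by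
    intro a b hb ha
    have := ha.tp_elim_eq hM hA hr (tp_eq_of_mem_locus hb b₀.2)
    exact ⟨hF.invariant this, hF.invariant this.symm⟩
  by_cases h₁ : F l b₀ <;> by_cases h₂ : F r b₀
  · have hF' : IsFinalRel P Q.reverse fun a b => ¬ F a b :=
      ⟨fun h hn hab => hn (hF.invariant h.symm hab),
        fun a b b' hn hlt hab => hn (hF.final a b' b hab hlt)⟩
    exact (hF'.not_of_nonempty hM hA hne' (b := b₀) hl hr (not_not.2 h₁) (not_not.2 h₂)).elim
  · exact Or.inl fun a b hb => ⟨fun h => (hL hb h).2 h₁, fun h hab => h₂ ((hR hb h).1 hab)⟩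
  · exact Or.inr fun a b hb => ⟨fun h hab => h₁ ((hL hb h).1 hab), fun h => (hR hb h).2 h₂⟩
  · exact (hF.not_of_nonempty hM hA hne hl hr h₁ h₂).elim

theorem separates_of_not_weaklyOrthogonal (hM : IsMonster L M) (hA : #A < #M)
    (h : ¬ WeaklyOrthogonal P.type Q.type) :
    (∀ a, ∀ b ∈ locus Q.type,
      (P.LeftGeneric (Set.range b) a → Q.RightGeneric (Set.range a) b) ∧
      (P.RightGeneric (Set.range b) a → ¬ Q.RightGeneric (Set.range a) b)) ∨
    (∀ a, ∀ b ∈ locus Q.type,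
      (P.LeftGeneric (Set.range b) a → ¬ Q.RightGeneric (Set.range a) b) ∧
      (P.RightGeneric (Set.range b) a → Q.RightGeneric (Set.range a) b)) := by
  have hF : IsFinalRel P Q fun a b => Q.RightGeneric (Set.range a) b :=
    ⟨fun h hab => hab.of_tp_eq hM hA (tp_swap h), fun a b b' hab hlt => hab.of_lt hM hA hlt⟩
  obtain ⟨a⟩ := P.nonempty_locus
  obtain ⟨l, hl⟩ := Q.exists_leftGeneric hM hA (Set.finite_range (a : Fin P.n → M))
  obtain ⟨r, hr⟩ := Q.exists_rightGeneric hM hA (Set.finite_range (a : Fin P.n → M))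
  exact hF.separates hM hA ⟨a, ⟨r, hr.mem_locus⟩, hr⟩ ⟨a, ⟨l, hl.mem_locus⟩, fun hn =>
    not_leftGeneric_and_rightGeneric hM hA (fun h' => h h'.symm) a.2 hl hn⟩

theorem directlyNonorthogonal_of_leftGeneric (hM : IsMonster L M) (hA : #A < #M)
    (h : ¬ WeaklyOrthogonal P.type Q.type)
    (hLR : ∀ a, ∀ b ∈ locus Q.type,
      P.LeftGeneric (Set.range b) a → Q.RightGeneric (Set.range a) b) :
    DirectlyNonorthogonal P Q := by
  have h' : ¬ WeaklyOrthogonal Q.type P.type := fun hn => h hn.symm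
  obtain ⟨b⟩ := Q.nonempty_locus
  obtain ⟨a, ha⟩ := P.exists_leftGeneric hM hA (Set.finite_range (b : Fin Q.n → M))
  have hab := hLR a b b.2 ha
  have hRL : ∀ b, ∀ a ∈ locus P.type,
      Q.RightGeneric (Set.range a) b → P.LeftGeneric (Set.range b) a := by
    rcases separates_of_not_weaklyOrthogonal (P := Q) (Q := P.reverse) hM hA h' with hs | hs
    · exact absurd ha ((hs b a ha.mem_locus).2 hab)
    · exact fun b a ha => (hs b a ha).2
  have hLR' : ∀ b, ∀ a ∈ locus P.type,
      Q.LeftGeneric (Set.range a) b → P.RightGeneric (Set.range b) a := by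
    rcases separates_of_not_weaklyOrthogonal (P := Q) (Q := P) hM hA h' with hs | hs
    · exact fun b a ha => (hs b a ha).1
    · exact (not_leftGeneric_and_rightGeneric hM hA h b.2 ha ((hs b a ha.mem_locus).2 hab)).elim
  have hRL' : ∀ a, ∀ b ∈ locus Q.type,
      P.RightGeneric (Set.range b) a → Q.LeftGeneric (Set.range a) b := by
    rcases separates_of_not_weaklyOrthogonal (P := P) (Q := Q.reverse) hM hA h with hs | hs
    · exact (not_leftGeneric_and_rightGeneric hM hA h' ha.mem_locus ((hs a b.1 b.2).1 ha) hab).elim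
    · exact fun a b hb => (hs a b hb).2
  exact ⟨h, fun a ha b hb => ⟨⟨hLR a b hb, hRL b a ha⟩, ⟨hRL' a b hb, hLR' b a ha⟩⟩⟩

theorem directlyNonorthogonal_or (hM : IsMonster L M) (hA : #A < #M)
    (h : ¬ WeaklyOrthogonal P.type Q.type) :
    DirectlyNonorthogonal P Q ∨ DirectlyNonorthogonal P.reverse Q := by
  rcases separates_of_not_weaklyOrthogonal hM hA h with hs | hs
  · exact Or.inl (directlyNonorthogonal_of_leftGeneric hM hA h fun a b hb => (hs a b hb).1)
  · exact Or.inr (directlyNonorthogonal_of_leftGeneric (P := P.reverse) hM hA h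
      fun a b hb => (hs a b hb).2)

end NonalgSOPair

open NonalgSOPair

variable {P Q R : NonalgSOPair L A}

theorem DirectlyNonorthogonal.reverse_right (h : DirectlyNonorthogonal P Q.reverse) :
    DirectlyNonorthogonal P.reverse Q :=
  ⟨h.1, fun a ha b hb => (h.2 a ha b hb).symm⟩

theorem DirectlyNonorthogonal.reverse_left (h : DirectlyNonorthogonal P.reverse Q) :
    DirectlyNonorthogonal P Q.reverse :=
  ⟨h.1, fun a ha b hb => (h.2 a ha b hb).symm⟩

theorem DirectlyNonorthogonal.symm (h : DirectlyNonorthogonal P Q) : DirectlyNonorthogonal Q P :=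
  ⟨fun hn => h.1 hn.symm, fun b hb a ha =>
    ⟨(h.2 a ha b hb).2.symm, (h.2 a ha b hb).1.symm⟩⟩

theorem DirectlyNonorthogonal.not_reverse (hM : IsMonster L M) (hA : #A < #M)
    (h : DirectlyNonorthogonal P Q) : ¬ DirectlyNonorthogonal P.reverse Q := by
  intro h'
  obtain ⟨b⟩ := Q.nonempty_locus
  obtain ⟨a, ha⟩ := P.exists_leftGeneric hM hA (Set.finite_range (b : Fin Q.n → M))
  exact not_leftGeneric_and_rightGeneric hM hA (fun h' => h.1 h'.symm) ha.mem_locus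
    ((h'.2 a ha.mem_locus b b.2).2.1 ha) ((h.2 a ha.mem_locus b b.2).1.1 ha)

theorem DirectlyNonorthogonal.refl (hM : IsMonster L M) (hA : #A < #M) (P : NonalgSOPair L A) :
    DirectlyNonorthogonal P P := by
  refine (directlyNonorthogonal_or hM hA (not_weaklyOrthogonal_self P.nonalgebraic)).resolve_right
    fun h => ?_
  obtain ⟨b⟩ := P.nonempty_locus
  obtain ⟨a, ha⟩ := P.exists_leftGeneric hM hA (Set.finite_range (b : Fin P.n → M))
  have hb := (h.2 a ha.mem_locus b b.2).2.1 ha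
  have h₁ := LeftGeneric.lt (a := ⟨a, ha.mem_locus⟩) hM hA ha subset_rfl
  have h₂ := LeftGeneric.lt (b := ⟨a, ha.mem_locus⟩) hM hA hb subset_rfl
  exact P.isSO.linear.irrefl _ (P.isSO.linear.trans _ _ _ h₁ h₂)

/-- The generic parts over two tuples cannot be nested in opposite ways. -/
theorem NonalgSOPair.not_crossing (hM : IsMonster L M) (hA : #A < #M) {α β : Type} [Finite α]
    [Finite β] {p : TypeOver L A α} {r : TypeOver L A β} (hp : ¬ WeaklyOrthogonal Q.type p)
    (hr : ¬ WeaklyOrthogonal Q.type r) {a : α → M} (ha : a ∈ locus p) {c : β → M}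
    (hc : c ∈ locus r) {b b' : Fin Q.n → M} (h₁ : Q.RightGeneric (Set.range a) b)
    (h₂ : Q.LeftGeneric (Set.range c) b) (h₃ : Q.LeftGeneric (Set.range a) b')
    (h₄ : Q.RightGeneric (Set.range c) b') : False := by
  have hlt : Q.lt ⟨b', h₃.mem_locus⟩ ⟨b, h₂.mem_locus⟩ :=
    lt_of_leftGeneric_of_not hM hA h₃
      fun h => not_leftGeneric_and_rightGeneric hM hA hp ha h h₁
  have hlt' : Q.lt ⟨b, h₂.mem_locus⟩ ⟨b', h₃.mem_locus⟩ :=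
    lt_of_leftGeneric_of_not hM hA h₂
      fun h => not_leftGeneric_and_rightGeneric hM hA hr hc h h₄
  exact Q.isSO.linear.irrefl _ (Q.isSO.linear.trans _ _ _ hlt hlt')

theorem DirectlyNonorthogonal.not_weaklyOrthogonal_trans (hM : IsMonster L M) (hA : #A < #M)
    (h : DirectlyNonorthogonal P Q) (h' : DirectlyNonorthogonal Q R) :
    ¬ WeaklyOrthogonal P.type R.type := by
  intro hPR
  obtain ⟨b⟩ := Q.nonempty_locus
  have hfin := Set.finite_range (b : Fin Q.n → M)
  obtain ⟨a, ha⟩ := P.exists_leftGeneric hM hA hfin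
  obtain ⟨a', ha'⟩ := P.exists_rightGeneric hM hA hfin
  obtain ⟨c, hc⟩ := R.exists_rightGeneric hM hA hfin
  obtain ⟨c', hc'⟩ := R.exists_leftGeneric hM hA hfin
  obtain ⟨b', hb'⟩ := hM.exists_tp_eq hA
    (hPR a' ha'.mem_locus c' hc'.mem_locus a ha.mem_locus c hc.mem_locus) (b : Fin Q.n → M)
  have h₁ := tp_comp (Sum.elim Sum.inl (Sum.inr ∘ Sum.inl) : Fin Q.n ⊕ Fin P.n → _) hb'
  have h₂ := tp_comp (Sum.elim Sum.inl (Sum.inr ∘ Sum.inr) : Fin Q.n ⊕ Fin R.n → _) hb'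
  simp only [Sum.comp_elim, Sum.elim_comp_inl, Sum.elim_comp_inr, ← Function.comp_assoc] at h₁ h₂
  exact not_crossing hM hA (fun hn => h.1 hn.symm) h'.1 ha.mem_locus hc.mem_locus
    ((h.2 a ha.mem_locus b b.2).1.1 ha) ((h'.2 b b.2 c hc.mem_locus).1.2 hc)
    (((h.2 a' ha'.mem_locus b b.2).2.1 ha').of_tp_eq hM hA h₁)
    (((h'.2 b b.2 c' hc'.mem_locus).2.2 hc').of_tp_eq hM hA h₂)

/-- If `a` is left generic over `c`, some element of `q(M)` is right generic over `a` and left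
generic over `c`. -/
theorem DirectlyNonorthogonal.exists_between (hM : IsMonster L M) (hA : #A < #M)
    (h : DirectlyNonorthogonal P Q) {a : Fin P.n → M} {m : ℕ} {c : Fin m → M}
    (hac : P.LeftGeneric (Set.range c) a) :
    ∃ b, Q.RightGeneric (Set.range a) b ∧ Q.LeftGeneric (Set.range c) b := by
  obtain ⟨b₀, hb₀⟩ := Q.exists_leftGeneric hM hA (Set.finite_range c)
  obtain ⟨a₀, ha₀⟩ := P.exists_leftGeneric hM hA
    ((Set.finite_range b₀).union (Set.finite_range c))
  obtain ⟨b, hb⟩ := hM.exists_tp_eq hA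
    ((ha₀.mono Set.subset_union_right).tp_elim_eq hM hA hac rfl) b₀
  have h₁ := tp_comp (Sum.elim Sum.inl (Sum.inr ∘ Sum.inl) : Fin Q.n ⊕ Fin P.n → _) hb
  have h₂ := tp_comp (Sum.elim Sum.inl (Sum.inr ∘ Sum.inr) : Fin Q.n ⊕ Fin m → _) hb
  simp only [Sum.comp_elim, Sum.elim_comp_inl, Sum.elim_comp_inr, ← Function.comp_assoc] at h₁ h₂
  exact ⟨b, ((h.2 a₀ ha₀.mem_locus b₀ hb₀.mem_locus).1.1
    (ha₀.mono Set.subset_union_left)).of_tp_eq hM hA h₁, hb₀.of_tp_eq hM hA h₂⟩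

theorem DirectlyNonorthogonal.trans (hM : IsMonster L M) (hA : #A < #M)
    (h : DirectlyNonorthogonal P Q) (h' : DirectlyNonorthogonal Q R) :
    DirectlyNonorthogonal P R := by
  refine (directlyNonorthogonal_or hM hA
    (h.not_weaklyOrthogonal_trans hM hA h')).resolve_right fun hn => ?_
  obtain ⟨c⟩ := R.nonempty_locus
  obtain ⟨a, hac⟩ := P.exists_leftGeneric hM hA (Set.finite_range (c : Fin R.n → M))
  obtain ⟨b, hba, hbc⟩ := h.exists_between hM hA hac
  have hca := (hn.2 a hac.mem_locus c c.2).2.1 hac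
  obtain ⟨b', hbc', hba'⟩ := h'.symm.exists_between hM hA hca
  exact not_crossing hM hA (fun hn => h.1 hn.symm) h'.1 hac.mem_locus c.2 hba hbc hba' hbc'

end Orthogonality

/-! ### Forking -/

section Forking

variable {A : Set M}

theorem exists_divides_of_definable {α β : Type} [Finite β] {D : Set (α ⊕ β → M)}
    (hD : A.Definable L D) {b : β → M} {c : ℕ → β → M} (hc : ∀ i, tp L A (c i) = tp L A b) {k : ℕ}
    (hk : ∀ s : Finset ℕ, s.card = k → ¬ ∃ x : α → M, ∀ i ∈ s, Sum.elim x (c i) ∈ D) :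
    ∃ (m : ℕ) (φ : L.Formula (α ⊕ Fin m)) (b' : Fin m → M), Divides A φ b' ∧
      ∀ x : α → M, φ.Realize (Sum.elim x b') ↔ Sum.elim x b ∈ D := by
  obtain ⟨A₀, hA₀, hD₀⟩ := Set.definable_iff_finitely_definable.1 hD
  obtain ⟨φ, rfl⟩ := Set.definable_iff_exists_formula_sum.1 hD₀
  let n := Fintype.card A₀
  let e₀ : (A₀ : Set M) ≃ Fin n := Fintype.equivFin A₀
  let e₁ : Fin n ⊕ β ≃ Fin (Nat.card (Fin n ⊕ β)) := Finite.equivFin _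
  let d : Fin n → M := fun i => (e₀.symm i : M)
  have hφ : ∀ (x : α → M) (y : β → M),
      (φ.relabel (Sum.elim (fun i => Sum.inr (e₁ (Sum.inl (e₀ i))))
        (Sum.elim Sum.inl fun j => Sum.inr (e₁ (Sum.inr j))))).Realize
          (Sum.elim x (Sum.elim d y ∘ e₁.symm)) ↔
        Sum.elim x y ∈ {v | φ.Realize (Sum.elim (↑) v)} := by
    intro x y
    rw [FirstOrder.Language.Formula.realize_relabel, Set.mem_ofPred_eq]
    refine iff_of_eq (congrArg _ ?_)
    funext i
    rcases i with i | i | i <;> simp [d]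
  refine ⟨_, _, Sum.elim d b ∘ e₁.symm, ⟨k, fun i => Sum.elim d (c i) ∘ e₁.symm,
    fun i => tp_comp _ (tp_swap (tp_eq_iff.2 fun E hE => ?_)), fun s hs => ?_⟩, fun x => hφ x b⟩
  · refine tp_eq_iff.1 (hc i) _ (definable_fiber hE subset_rfl ?_)
    rintro _ ⟨j, rfl⟩
    exact hA₀ (e₀.symm j).2
  · simp only [hφ]
    exact hk s hs

namespace NonalgSOPair

variable {P : NonalgSOPair L A}

/-- Generic realizations are independent. -/
theorem LeftGeneric.indep (hM : IsMonster L M) (hA : #A < #M) {a : Fin P.n → M} {β : Type}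
    [Finite β] {b : β → M} (ha : P.LeftGeneric (Set.range b) a) : Indep L A a b := by
  rintro ⟨k, m, φ, d, hdiv, hcov⟩
  obtain ⟨a', ha'⟩ := P.exists_leftGeneric hM hA
    ((Set.finite_range b).union (Set.finite_iUnion fun j => Set.finite_range (d j)))
  obtain ⟨j, hj⟩ := hcov a' ((ha'.mono Set.subset_union_left).tp_eq ha)
  obtain ⟨k, c, hc, hk⟩ := hdiv j
  have hD : A.Definable L {v | (φ j).Realize v} :=
    (Set.empty_definable_iff.2 ⟨φ j, rfl⟩).mono (Set.empty_subset A)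
  have ha'' : P.LeftGeneric (Set.range (d j)) a' :=
    ha'.mono ((Set.subset_iUnion (fun j => Set.range (d j)) j).trans Set.subset_union_right)
  have hl : LeftEventual P.lt
      {x : locus P.type | Sum.elim (x : Fin P.n → M) (d j) ∈ {v | (φ j).Realize v}} := by
    refine (P.leftEventual_or (definable_fiber (b := d j) hD Set.subset_union_left
      Set.subset_union_right)).resolve_right fun hl => ?_
    exact leftGeneric_range_iff.1 ha'' _ hD.compl hl hj
  have key : ∀ s : Finset ℕ, LeftEventual P.lt
      {x : locus P.type | ∀ i ∈ s, (φ j).Realize (Sum.elim (x : Fin P.n → M) (c i))} := by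
    intro s
    induction s using Finset.induction_on with
    | empty =>
      obtain ⟨x⟩ := P.nonempty_locus
      exact (leftEventual_iff P.isSO.linear).2 ⟨x, by simp⟩
    | insert i s _ ih =>
      have := (leftEventual_of_tp_eq hM hA hD (hc i).symm hl).inter P.isSO.linear ih
      refine (congrArg (LeftEventual P.lt) (Set.ext fun x => ?_)).mp this
      simp
  obtain ⟨x, hx⟩ := (key (Finset.range k)).nonempty
  exact hk (Finset.range k) (Finset.card_range k) ⟨x, hx⟩

theorem RightGeneric.indep (hM : IsMonster L M) (hA : #A < #M) {a : Fin P.n → M} {β : Type}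
    [Finite β] {b : β → M} (ha : P.RightGeneric (Set.range b) a) : Indep L A a b :=
  LeftGeneric.indep (P := P.reverse) hM hA ha

/-- Strict inequalities on `p(M)` are separated by a formula of `p`. -/
theorem exists_definable_separating (hM : IsMonster L M) (hA : #A < #M)
    {D : Set (Fin P.n ⊕ Fin P.n → M)} (hD : A.Definable L D)
    (hlt : ∀ a b : locus P.type, P.lt a b ↔ Sum.elim (a : Fin P.n → M) (b : Fin P.n → M) ∈ D)
    {y z : locus P.type} (hzy : P.lt z y) :
    ∃ E : Set (Fin P.n → M), A.Definable L E ∧ locus P.type ⊆ E ∧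
      ∀ x ∈ E, Sum.elim (y : Fin P.n → M) x ∈ D → Sum.elim x (z : Fin P.n → M) ∉ D := by
  by_contra! hn
  have hyD : (A ∪ (Set.range (y : Fin P.n → M) ∪ Set.range (z : Fin P.n → M))).Definable L
      {x | Sum.elim (y : Fin P.n → M) x ∈ D} := by
    have := definable_fiber (b := (y : Fin P.n → M)) (hD.preimage_comp Sum.swap)
      (Set.subset_union_left (t := Set.range (y : Fin P.n → M) ∪ Set.range (z : Fin P.n → M)))
      (Set.subset_union_left.trans Set.subset_union_right)
    refine (congrArg _ (Set.ext fun x => ?_)).mp this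
    rw [Set.mem_ofPred_eq, Set.mem_preimage, Set.mem_ofPred_eq]
    refine iff_of_eq (congrArg (· ∈ D) ?_)
    funext i
    rcases i with i | i <;> rfl
  have hzD : (A ∪ (Set.range (y : Fin P.n → M) ∪ Set.range (z : Fin P.n → M))).Definable L
      {x | Sum.elim x (z : Fin P.n → M) ∈ D} :=
    definable_fiber hD Set.subset_union_left
      (Set.subset_union_right.trans Set.subset_union_right)
  obtain ⟨x, hx⟩ := hM.saturated.exists_mem_of_inter_closed
    (hM.union_lt hA ((Set.finite_range (y : Fin P.n → M)).union
      (Set.finite_range (z : Fin P.n → M))))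
    {F | ∃ E : Set (Fin P.n → M), A.Definable L E ∧ locus P.type ⊆ E ∧
      F = E ∩ ({x | Sum.elim (y : Fin P.n → M) x ∈ D} ∩ {x | Sum.elim x (z : Fin P.n → M) ∈ D})}
    (by
      rintro _ ⟨E, hE, -, rfl⟩
      exact (hE.mono Set.subset_union_left).inter (hyD.inter hzD))
    (by
      rintro _ ⟨E, hE, hpE, rfl⟩
      obtain ⟨x, hx, hx'⟩ := hn E hE hpE
      exact ⟨x, hx, hx'⟩)
    (by
      rintro _ ⟨E, hE, hpE, rfl⟩ _ ⟨E', hE', hpE', rfl⟩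
      exact ⟨E ∩ E', hE.inter hE', Set.subset_inter hpE hpE',
        (Set.inter_inter_distrib_right E E' _).symm⟩)
  have hsub : ∀ E : Set (Fin P.n → M), A.Definable L E → (y : Fin P.n → M) ∈ E →
      locus P.type ⊆ E :=
    fun E hE hyE x hx => (tp_eq_iff.1 (tp_eq_of_mem_locus y.2 hx) E hE).1 hyE
  have hxl : x ∈ locus P.type := by
    refine mem_locus_of_tp_eq y.2 (tp_eq_iff.2 fun E hE => ⟨fun hyE => ?_, fun hxE => ?_⟩)
    · exact (hx _ ⟨E, hE, hsub E hE hyE, rfl⟩).1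
    · by_contra hyE
      exact (hx _ ⟨Eᶜ, hE.compl, hsub Eᶜ hE.compl hyE, rfl⟩).1 hxE
  have hx' := (hx _ ⟨Set.univ, Set.definable_univ, Set.subset_univ _, rfl⟩).2
  exact P.isSO.linear.irrefl z (P.isSO.linear.trans _ _ _ hzy
    (P.isSO.linear.trans _ _ _ ((hlt y ⟨x, hxl⟩).2 hx'.1) ((hlt ⟨x, hxl⟩ z).2 hx'.2)))

/-- Intervals of `p(M)` are contained in definable sets that divide over `A`. -/
theorem exists_divides_interval (hM : IsMonster L M) (hA : #A < #M) {y z : locus P.type} :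
    ∃ (m : ℕ) (φ : L.Formula (Fin P.n ⊕ Fin m)) (d : Fin m → M), Divides A φ d ∧
      ∀ x : locus P.type, P.lt y x → P.lt x z → φ.Realize (Sum.elim (x : Fin P.n → M) d) := by
  obtain ⟨D, hD, hlt⟩ := P.isSO.definable
  obtain ⟨y₁, hy₁⟩ := P.exists_rightGeneric hM hA (Set.finite_range (z : Fin P.n → M))
  have hzy₁ : P.lt z ⟨y₁, hy₁.mem_locus⟩ :=
    LeftGeneric.lt (P := P.reverse) (a := ⟨y₁, hy₁.mem_locus⟩) hM hA hy₁ subset_rfl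
  obtain ⟨E, hE, hpE, hsep⟩ := exists_definable_separating hM hA hD hlt hzy₁
  let G : Set (Fin P.n ⊕ (Fin P.n ⊕ Fin P.n) → M) :=
    (fun v => v ∘ Sum.inl) ⁻¹' E ∩
      ((fun v => v ∘ Sum.elim (Sum.inr ∘ Sum.inl) Sum.inl) ⁻¹' D ∩
        (fun v => v ∘ Sum.elim Sum.inl (Sum.inr ∘ Sum.inr)) ⁻¹' D)
  have hG : A.Definable L G := (hE.preimage_comp _).inter
    ((hD.preimage_comp _).inter (hD.preimage_comp _))
  have hmem : ∀ x y z : Fin P.n → M, Sum.elim x (Sum.elim y z) ∈ G ↔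
      x ∈ E ∧ Sum.elim y x ∈ D ∧ Sum.elim x z ∈ D := by
    intro x y z
    simp only [G, Set.mem_inter_iff, Set.mem_preimage, Sum.comp_elim, Sum.elim_comp_inl,
      Sum.elim_comp_inr, ← Function.comp_assoc]
  obtain ⟨f, hf, hr⟩ := exists_seq_of_forall_finset_exists
    (fun c : (Fin P.n → M) × (Fin P.n → M) => tp L A (Sum.elim c.1 c.2) =
      tp L A (Sum.elim (y : Fin P.n → M) (z : Fin P.n → M)))
    (fun c c' => P.RightGeneric (Set.range c.2) c'.1)
    (by
      intro s _
      obtain ⟨y', hy'⟩ := P.exists_rightGeneric hM hA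
        (s.finite_toSet.biUnion fun c _ => Set.finite_range c.2)
      obtain ⟨z', hz'⟩ := hM.exists_tp_eq hA (tp_eq_of_mem_locus y.2 hy'.mem_locus)
        (z : Fin P.n → M)
      exact ⟨(y', z'), (tp_swap hz').symm, fun c hc => LeftGeneric.mono (P := P.reverse) hy'
        (Set.subset_biUnion_of_mem (u := fun c : (Fin P.n → M) × (Fin P.n → M) => Set.range c.2)
          hc)⟩)
  have hdisj : ∀ i j, i < j → ∀ x, Sum.elim x (Sum.elim (f i).1 (f i).2) ∈ G →
      Sum.elim x (Sum.elim (f j).1 (f j).2) ∉ G := by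
    intro i j hij x hi hj
    rw [hmem] at hi hj
    have ht := (hr i j hij).tp_elim_eq hM hA hy₁ (tp_inr (hf i))
    obtain ⟨x', hx'⟩ := hM.exists_tp_eq hA ht x
    have := (hmem _ _ _).1 ((tp_eq_iff.1 hx' G hG).1 ((hmem _ _ _).2 ⟨hi.1, hj.2.1, hi.2.2⟩))
    exact hsep x' this.1 this.2.1 this.2.2
  obtain ⟨m, φ, d, hdiv, hφ⟩ := exists_divides_of_definable hG
    (b := Sum.elim (y : Fin P.n → M) (z : Fin P.n → M))
    (c := fun i => Sum.elim (f i).1 (f i).2) hf (k := 2) (by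
      rintro s hs ⟨x, hx⟩
      obtain ⟨i, j, hij, rfl⟩ := Finset.card_eq_two.1 hs
      rcases hij.lt_or_gt with h | h
      · exact hdisj i j h x (hx i (by simp)) (hx j (by simp))
      · exact hdisj j i h x (hx j (by simp)) (hx i (by simp)))
  exact ⟨m, φ, d, hdiv, fun x hyx hxz => (hφ x).2
    ((hmem _ _ _).2 ⟨hpE x.2, (hlt _ _).1 hyx, (hlt _ _).1 hxz⟩)⟩

/-- Independence of a realization of an so-type from a tuple means that it is generic. -/
theorem indep_iff (hM : IsMonster L M) (hA : #A < #M) {a : Fin P.n → M} (ha : a ∈ locus P.type)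
    {β : Type} [Finite β] {b : β → M} :
    Indep L A a b ↔ P.LeftGeneric (Set.range b) a ∨ P.RightGeneric (Set.range b) a := by
  refine ⟨fun h => ?_, fun h => h.elim (fun h => h.indep hM hA) fun h => h.indep hM hA⟩
  by_contra! hn
  refine h ?_
  obtain ⟨y, hy⟩ := P.exists_leftGeneric hM hA (Set.finite_range b)
  obtain ⟨z, hz⟩ := P.exists_rightGeneric hM hA (Set.finite_range b)
  obtain ⟨m, φ, d, hdiv, hφ⟩ := exists_divides_interval hM hA
    (y := ⟨y, hy.mem_locus⟩) (z := ⟨z, hz.mem_locus⟩)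
  refine ⟨1, fun _ => m, fun _ => φ, fun _ => d, fun _ => hdiv, fun x hx => ⟨0, ?_⟩⟩
  have hxa : tp L A (Sum.elim x b) = tp L A (Sum.elim a b) := tp_union_range_eq_iff.1 hx
  have hxl : x ∈ locus P.type := mem_locus_of_tp_eq ha (tp_inl hxa).symm
  exact hφ ⟨x, hxl⟩
    (lt_of_leftGeneric_of_not (a := ⟨y, hy.mem_locus⟩) (c := ⟨x, hxl⟩) hM hA hy
      fun h => hn.1 (h.of_tp_eq hM hA hxa))
    (lt_of_rightGeneric_of_not (a := ⟨z, hz.mem_locus⟩) (c := ⟨x, hxl⟩) hM hA hz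
      fun h => hn.2 (h.of_tp_eq hM hA hxa))

end NonalgSOPair

end Forking

/-! ### Equivalence relations -/

section Equivalences

variable {A : Set M} {P Q R : NonalgSOPair L A}

theorem not_weaklyOrthogonal_trans (hM : IsMonster L M) (hA : #A < #M)
    (h : ¬ WeaklyOrthogonal P.type Q.type) (h' : ¬ WeaklyOrthogonal Q.type R.type) :
    ¬ WeaklyOrthogonal P.type R.type := by
  rcases NonalgSOPair.directlyNonorthogonal_or hM hA h' with hQ | hQ
  · rcases NonalgSOPair.directlyNonorthogonal_or hM hA h with hP | hP
    exacts [(hP.trans hM hA hQ).1, (hP.trans hM hA hQ).1]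
  · rcases NonalgSOPair.directlyNonorthogonal_or (Q := Q.reverse) hM hA h with hP | hP
    exacts [(hP.trans hM hA hQ).1, (hP.trans hM hA hQ).1]

theorem WeaklyOrthogonal.indep (hM : IsMonster L M) (hA : #A < #M) {β : Type} [Finite β]
    {q : TypeOver L A β} (h : WeaklyOrthogonal P.type q) {a : Fin P.n → M} (ha : a ∈ locus P.type)
    {b : β → M} (hb : b ∈ locus q) : Indep L A a b := by
  obtain ⟨l, hl⟩ := P.exists_leftGeneric hM hA (Set.finite_range b)
  exact (hl.of_tp_eq hM hA (h l hl.mem_locus b hb a ha b hb)).indep hM hA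

theorem DirectlyNonorthogonal.indep_comm (hM : IsMonster L M) (hA : #A < #M)
    (h : DirectlyNonorthogonal P Q) {a : Fin P.n → M} (ha : a ∈ locus P.type)
    {b : Fin Q.n → M} (hb : b ∈ locus Q.type) : Indep L A a b ↔ Indep L A b a := by
  rw [NonalgSOPair.indep_iff hM hA ha, NonalgSOPair.indep_iff hM hA hb, (h.2 a ha b hb).1,
    (h.2 a ha b hb).2, or_comm]

theorem not_indep_self (hM : IsMonster L M) (hA : #A < #M) {a : Fin P.n → M}
    (ha : a ∈ locus P.type) : ¬ Indep L A a a := by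
  rw [NonalgSOPair.indep_iff hM hA ha]
  rintro (h | h)
  · exact P.isSO.linear.irrefl _
      (NonalgSOPair.LeftGeneric.lt (a := ⟨a, ha⟩) (b := ⟨a, ha⟩) hM hA h subset_rfl)
  · exact P.isSO.linear.irrefl _ (NonalgSOPair.LeftGeneric.lt (P := P.reverse)
      (a := ⟨a, ha⟩) (b := ⟨a, ha⟩) hM hA h subset_rfl)

theorem not_indep_symm (hM : IsMonster L M) (hA : #A < #M) {a : Fin P.n → M}
    (ha : a ∈ locus P.type) {b : Fin Q.n → M} (hb : b ∈ locus Q.type) (h : ¬ Indep L A a b) :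
    ¬ Indep L A b a := by
  rcases NonalgSOPair.directlyNonorthogonal_or hM hA fun hw => h (hw.indep hM hA ha hb)
    with hPQ | hPQ
  · rwa [← hPQ.indep_comm hM hA ha hb]
  · exact fun hba =>
      h ((DirectlyNonorthogonal.indep_comm (P := P.reverse) hM hA hPQ ha hb).2 hba)

theorem DirectlyNonorthogonal.indep_or_indep (hM : IsMonster L M) (hA : #A < #M)
    (h : DirectlyNonorthogonal P Q) {a : Fin P.n → M}
    {b : Fin Q.n → M} (hb : b ∈ locus Q.type) {m : ℕ} {c : Fin m → M}
    (hac : P.LeftGeneric (Set.range c) a) : Indep L A b a ∨ Indep L A b c := by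
  by_contra! hn
  obtain ⟨b', hba, hbc⟩ := h.exists_between hM hA hac
  have h₁ : Q.lt ⟨b, hb⟩ ⟨b', hba.mem_locus⟩ :=
    NonalgSOPair.lt_of_rightGeneric_of_not (c := ⟨b, hb⟩) hM hA hba fun h => hn.1 (h.indep hM hA)
  have h₂ : Q.lt ⟨b', hba.mem_locus⟩ ⟨b, hb⟩ :=
    NonalgSOPair.lt_of_leftGeneric_of_not (c := ⟨b, hb⟩) hM hA hbc fun h => hn.2 (h.indep hM hA)
  exact Q.isSO.linear.irrefl _ (Q.isSO.linear.trans _ _ _ h₁ h₂)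

theorem not_indep_trans (hM : IsMonster L M) (hA : #A < #M) {a : Fin P.n → M}
    (ha : a ∈ locus P.type) {b : Fin Q.n → M} (hb : b ∈ locus Q.type) {m : ℕ} {c : Fin m → M}
    (h : ¬ Indep L A a b) (h' : ¬ Indep L A b c) : ¬ Indep L A a c := by
  have hba := not_indep_symm hM hA ha hb h
  have key : ∀ P' : NonalgSOPair L A, ¬ WeaklyOrthogonal P'.type Q.type → ∀ a : Fin P'.n → M,
      P'.LeftGeneric (Set.range c) a → Indep L A b a ∨ Indep L A b c := by
    intro P' hw a hac
    rcases NonalgSOPair.directlyNonorthogonal_or hM hA hw with hPQ | hPQ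
    · exact hPQ.indep_or_indep hM hA hb hac
    · exact DirectlyNonorthogonal.indep_or_indep (P := P') (Q := Q.reverse) hM hA hPQ.reverse_left
        hb hac
  have hw : ¬ WeaklyOrthogonal P.type Q.type := fun hw => h (hw.indep hM hA ha hb)
  rw [NonalgSOPair.indep_iff hM hA ha]
  rintro (hac | hac)
  · exact (key P hw a hac).elim hba h'
  · exact (key P.reverse hw a hac).elim hba h'

/-- An so-pair whose underlying type is the given so-type. -/
noncomputable def NonalgSOType.pair (p : NonalgSOType L A) : NonalgSOPair L A where
  n := p.n
  type := p.type
  lt := p.isSO.choose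
  isSO := p.isSO.choose_spec
  nonalgebraic := p.nonalgebraic

/-- The type over `A` of a realization of an so-type. -/
def NonalgSORealization.type (a : NonalgSORealization L A) : NonalgSOType L A where
  n := a.n
  type := tp L A a.tuple
  isSO := a.isSO
  nonalgebraic := a.nonalgebraic

theorem equivalence_not_weaklyOrthogonal_type (hM : IsMonster L M) (hA : #A < #M) :
    Equivalence fun p q : NonalgSOType L A => ¬ WeaklyOrthogonal p.type q.type where
  refl p := not_weaklyOrthogonal_self p.nonalgebraic
  symm h := fun hn => h hn.symm
  trans {p q r} h h' := not_weaklyOrthogonal_trans (P := p.pair) (Q := q.pair) (R := r.pair)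
    hM hA h h'

theorem equivalence_not_weaklyOrthogonal_pair (hM : IsMonster L M) (hA : #A < #M) :
    Equivalence fun P Q : NonalgSOPair L A => ¬ WeaklyOrthogonal P.type Q.type where
  refl P := not_weaklyOrthogonal_self P.nonalgebraic
  symm h := fun hn => h hn.symm
  trans h h' := not_weaklyOrthogonal_trans hM hA h h'

theorem equivalence_directlyNonorthogonal (hM : IsMonster L M) (hA : #A < #M) :
    Equivalence fun P Q : NonalgSOPair L A => DirectlyNonorthogonal P Q where
  refl := DirectlyNonorthogonal.refl hM hA
  symm := DirectlyNonorthogonal.symm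
  trans h h' := h.trans hM hA h'

theorem equivalence_not_indep (hM : IsMonster L M) (hA : #A < #M) :
    Equivalence fun a b : NonalgSORealization L A => ¬ Indep L A a.tuple b.tuple where
  refl a := not_indep_self (P := a.type.pair) hM hA rfl
  symm {a b} h := not_indep_symm (P := a.type.pair) (Q := b.type.pair) hM hA rfl rfl h
  trans {a b _} h h' := not_indep_trans (P := a.type.pair) (Q := b.type.pair) hM hA rfl rfl h h'

theorem not_forkingOrthogonal_iff {α β : Type} {p : TypeOver L A α} {q : TypeOver L A β} :
    ¬ ForkingOrthogonal p q ↔ ∃ a ∈ locus p, ∃ b ∈ locus q, ¬ Indep L A a b := by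
  simp only [ForkingOrthogonal, not_forall, exists_prop]

theorem not_indep_of_tp_eq (hM : IsMonster L M) (hA : #A < #M) {β : Type} [Finite β]
    {a a' : Fin P.n → M} {b b' : β → M} (ha : a ∈ locus P.type)
    (h : tp L A (Sum.elim a b) = tp L A (Sum.elim a' b')) (hn : ¬ Indep L A a b) :
    ¬ Indep L A a' b' := by
  rw [NonalgSOPair.indep_iff hM hA ha] at hn
  rw [NonalgSOPair.indep_iff hM hA (mem_locus_of_tp_eq ha (tp_inl h))]
  exact fun hn' => hn (hn'.imp (fun hg => hg.of_tp_eq hM hA h.symm)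
    fun hg => hg.of_tp_eq hM hA h.symm)

theorem equivalence_not_forkingOrthogonal (hM : IsMonster L M) (hA : #A < #M) :
    Equivalence fun p q : NonalgSOType L A => ¬ ForkingOrthogonal p.type q.type where
  refl p := by
    obtain ⟨a, ha⟩ := p.nonalgebraic.nonempty
    exact not_forkingOrthogonal_iff.2 ⟨a, ha, a, ha, not_indep_self (P := p.pair) hM hA ha⟩
  symm {p q} h := by
    obtain ⟨a, ha, b, hb, hab⟩ := not_forkingOrthogonal_iff.1 h
    exact not_forkingOrthogonal_iff.2
      ⟨b, hb, a, ha, not_indep_symm (P := p.pair) (Q := q.pair) hM hA ha hb hab⟩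
  trans {p q r} h h' := by
    obtain ⟨a, ha, b, hb, hab⟩ := not_forkingOrthogonal_iff.1 h
    obtain ⟨b', hb', c', hc', hbc'⟩ := not_forkingOrthogonal_iff.1 h'
    obtain ⟨c, hc⟩ := hM.exists_tp_eq hA (tp_eq_of_mem_locus hb' hb) c'
    exact not_forkingOrthogonal_iff.2 ⟨a, ha, c, mem_locus_of_tp_eq hc' (tp_inl hc),
      not_indep_trans (P := p.pair) (Q := q.pair) hM hA ha hb hab
        (not_indep_of_tp_eq (P := q.pair) hM hA hb' (tp_swap hc) hbc')⟩

end Equivalences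

end SOTypes

theorem mainTheorem7 {L : FirstOrder.Language.{u, v}} {M : Type w} [L.Structure M] [Nonempty M]
    (hM : SOTypes.IsMonster L M) (A : Set M) (hA : #A < #M) :
    -- weak nonorthogonality
    (Equivalence (fun p q : SOTypes.NonalgSOType L A => ¬ SOTypes.WeaklyOrthogonal p.type q.type) ∧
      Equivalence (fun P Q : SOTypes.NonalgSOPair L A => ¬ SOTypes.WeaklyOrthogonal P.type Q.type)) ∧
    -- direct nonorthogonality
    (Equivalence (fun P Q : SOTypes.NonalgSOPair L A => SOTypes.DirectlyNonorthogonal P Q) ∧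
      (∀ P Q : SOTypes.NonalgSOPair L A, SOTypes.DirectlyNonorthogonal P Q →
        ¬ SOTypes.WeaklyOrthogonal P.type Q.type) ∧
      ∀ P : SOTypes.NonalgSOPair L A, ∃ P₁ P₂ : SOTypes.NonalgSOPair L A,
        ∃ C₁ C₂ : Set (SOTypes.NonalgSOPair L A),
        C₁ = {Q | SOTypes.DirectlyNonorthogonal P₁ Q} ∧
        C₂ = {Q | SOTypes.DirectlyNonorthogonal P₂ Q} ∧
        Disjoint C₁ C₂ ∧
        C₁ ∪ C₂ = {Q | ¬ SOTypes.WeaklyOrthogonal P.type Q.type} ∧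
        C₂ = SOTypes.NonalgSOPair.reverse '' C₁ ∧ C₁ = SOTypes.NonalgSOPair.reverse '' C₂) ∧
    -- forking dependence
    Equivalence (fun a b : SOTypes.NonalgSORealization L A => ¬ SOTypes.Indep L A a.tuple b.tuple) ∧
    -- forking nonorthogonality
    Equivalence (fun p q : SOTypes.NonalgSOType L A => ¬ SOTypes.ForkingOrthogonal p.type q.type) := by
  refine ⟨⟨SOTypes.equivalence_not_weaklyOrthogonal_type hM hA,
    SOTypes.equivalence_not_weaklyOrthogonal_pair hM hA⟩,
    ⟨SOTypes.equivalence_directlyNonorthogonal hM hA, fun P Q h => h.1, fun P =>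
      ⟨P, P.reverse, _, _, rfl, rfl, ?_, ?_, ?_, ?_⟩⟩,
    SOTypes.equivalence_not_indep hM hA, SOTypes.equivalence_not_forkingOrthogonal hM hA⟩
  · exact Set.disjoint_left.2 fun Q h h' => h.not_reverse hM hA h'
  · ext Q
    exact ⟨fun h => h.elim (fun h => h.1) fun h => h.1,
      fun h => SOTypes.NonalgSOPair.directlyNonorthogonal_or hM hA h⟩
  · ext Q
    constructor
    · exact fun h => ⟨Q.reverse, h.reverse_left, rfl⟩
    · rintro ⟨Q, h, rfl⟩
      exact SOTypes.DirectlyNonorthogonal.reverse_right (Q := Q.reverse) h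
  · ext Q
    constructor
    · exact fun h => ⟨Q.reverse, SOTypes.DirectlyNonorthogonal.reverse_right (Q := Q.reverse) h, rfl⟩
    · rintro ⟨Q, h, rfl⟩
      exact h.reverse_left
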